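/- Let $E\subset\mathbb R^d$ be nonempty and compact, $\mathcal P(E)$ the Borel probability measures on $E$, $\mathcal P_1(E)$ those with finite first moment, and for $\mu,\nu\in\mathcal P_1(E)$ let $$\mathbb W_1(\mu,\nu)=\inf_{\pi}\iint_{E\times E}\|x-y\|_1\,\pi(dx,dy),$$ the infimum being over all couplings $\pi$ of $\mu$ and $\nu$. The Wasserstein contraction coefficient of a map $\Phi$ of $\mathcal P_1(E)$ into itself is $\tau(\Phi)=\sup_{\mu\ne\nu}\mathbb W_1(\Phi(\mu),\Phi(\nu))/\mathbb W_1(\mu,\nu)\in[0,\infty]$, with $\tau(\Phi)=0$ if there are no two distinct measures. Let $H\ge1$, let $W^Q_h,W^K_h,W^V_h,W^O_h\in\mathbb R^{d'\times d}$ for $h=1,\dots,H$ be matrices, and let $f:\mathbb R^d\to E$ be a measurable map (the feedforward network; only its values on outputs of multi-head attention matter, so a measurable $f:E\to E$ is covered whenever these outputs lie in $E$). Put $a_h(x,y)=\langle W^Q_hx,W^K_hy\rangle/\sqrt d$ and $G_h=e^{a_h}$. For $X=(x_1,\dots,x_N)\in E^N$ let $$\mathrm{Transformer}(X)_i=f\Big(\sum_{h=1}^H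 y_i^hW_h^O\Big),\qquad y_i^h=\sum_{j=1}^N\frac{e^{a_h(x_i,x_j)}}{\sum_{k=1}^Ne^{a_h(x_i,x_k)}}\,W^V_hx_j ,$$ where $y_i^h$ is multiplied by $W^O_h$ as a row vector. At the level of measures, for $\mu\in\mathcal P(E)$ and $x\in E$ let $$\Psi_{G_h(x,\cdot)}(\mu)(dy)=\frac{G_h(x,y)\,\mu(dy)}{\int G_h(x,z)\,\mu(dz)},\quad L_h(y,\cdot)=\delta_{W^V_hy},\quad \Pi(\rho)=\delta_{\int v\,\rho(dv)},\quad O_h(z,\cdot)=\delta_{H\,zW^O_h},\quad F(z,\cdot)=\delta_{f(z)},$$ $$A^h_\mu(x,\cdot)=\Pi\big[\Psi_{G_h(x,\cdot)}(\mu)L_h\big],\qquad M_\mu(x,\cdot)=\Pi\Big[\frac1H\sum_{h=1}^H (A^h_\mu O_h)(x,\cdot)\Big],\qquad \mathbf T_\mu=M_\mu F,$$ and regard $\mathbf T$ as the nonlinear map $\mu\mapsto\mu\mathbf T_\mu$ on $\mathcal P_1(E)$. If $\tau(\mathbf T)<1$, then the Universal Transformer recurrence $X^{\ell+1}=\mathrm{Transformer}(X^\ell)$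 has a unique fixed point: there is exactly one $\mu\in\mathcal P_1(E)$ with $\mu\mathbf T_\mu=\mu$, and for every $N\ge1$ there is exactly one $X\in E^N$ with $\mathrm{Transformer}(X)=X$. -/

import Mathlib

open MeasureTheory ProbabilityTheory
open scoped ENNReal Matrix

noncomputable section

namespace Attn

/-! ## The 1-Wasserstein distance for the 1-norm and the contraction coefficient -/

section Wasserstein

variable {d : ℕ} {E : Set (Fin d → ℝ)}

/-- The distance `‖x - y‖₁`. -/
def l1Dist (x y : Fin d → ℝ) : ℝ := ∑ i, |x i - y i|

/-- The set of probability measures on `E` with finite first moment. -/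
def P1 (E : Set (Fin d → ℝ)) : Set (ProbabilityMeasure E) :=
  {μ | ∫⁻ x, ENNReal.ofReal (l1Dist (x : Fin d → ℝ) 0) ∂(μ : Measure E) < ∞}

/-- Measures on `E × E` with marginals `μ` and `ν`. -/
def couplings (μ ν : ProbabilityMeasure E) : Set (Measure (E × E)) :=
  {π | π.map Prod.fst = (μ : Measure E) ∧ π.map Prod.snd = (ν : Measure E)}

/-- The 1-Wasserstein distance with cost `‖x - y‖₁`. -/
def W1 (μ ν : ProbabilityMeasure E) : ℝ≥0∞ :=
  ⨅ π ∈ couplings μ ν, ∫⁻ p, ENNReal.ofReal (l1Dist (p.1 : Fin d → ℝ) (p.2 : Fin d → ℝ)) ∂π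

/-- The Wasserstein contraction coefficient of a (possibly nonlinear) map of measures,
a supremum over distinct measures with finite first moment. -/
def contractionCoeff (Φ : ProbabilityMeasure E → ProbabilityMeasure E) : ℝ≥0∞ :=
  ⨆ μ ∈ P1 E, ⨆ ν ∈ P1 E, ⨆ _ : μ ≠ ν, W1 (Φ μ) (Φ ν) / W1 μ ν

end Wasserstein

/-! ## The building blocks of the attention kernel -/

section Kernels

variable {α β : Type*} [MeasurableSpace α] [MeasurableSpace β]

/-- The Boltzmann-Gibbs transformation `Ψ_g(ν)(dx) = g(x) ν(dx) / ν(g)`. -/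
def boltzmannGibbs (g : α → ℝ) (ν : Measure α) : Measure α :=
  ν.withDensity fun x => ENNReal.ofReal (g x / ∫ y, g y ∂ν)

lemma measurable_boltzmannGibbs (G : α → α → ℝ) (hG : Measurable (Function.uncurry G))
    (ν : ProbabilityMeasure α) :
    Measurable fun x => boltzmannGibbs (G x) (ν : Measure α) := by
  have hint : Measurable fun x => ∫ y, G x y ∂(ν : Measure α) :=
    (hG.stronglyMeasurable.integral_prod_right (ν := (ν : Measure α))).measurable
  have hm : Measurable (Function.uncurry fun x y =>
      ENNReal.ofReal (G x y / ∫ z, G x z ∂(ν : Measure α))) :=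
    (hG.div (hint.comp measurable_fst)).ennreal_ofReal
  have h := (Kernel.withDensity (Kernel.const α (ν : Measure α)) fun x y =>
      ENNReal.ofReal (G x y / ∫ z, G x z ∂(ν : Measure α))).measurable
  convert h using 2 with x
  rw [Kernel.withDensity_apply _ hm, Kernel.const_apply]
  rfl

/-- The softmatch kernel `Ψ_G(ν)(x, dy) = Ψ_{G(x,·)}(ν)(dy)`. -/
def softmatchKernel (G : α → α → ℝ) (hG : Measurable (Function.uncurry G))
    (ν : ProbabilityMeasure α) : Kernel α α :=
  ⟨fun x => boltzmannGibbs (G x) (ν : Measure α), measurable_boltzmannGibbs G hG ν⟩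

/-- The moment projection onto Dirac measures, `Π(μ) = δ_{μ(F)}` with `F(x) = x`. -/
def momentProjection {k : ℕ} (μ : Measure (Fin k → ℝ)) : Measure (Fin k → ℝ) :=
  Measure.dirac (∫ x, x ∂μ)

/-- The kernel `(Π ∘ κ)(x, ·) = Π(κ(x, ·))`. -/
def projKernel {k : ℕ} (κ : Kernel α (Fin k → ℝ)) : Kernel α (Fin k → ℝ) :=
  ⟨fun x => momentProjection (κ x), Measure.measurable_dirac.comp
    (StronglyMeasurable.integral_kernel (κ := κ) stronglyMeasurable_id).measurable⟩

instance {k : ℕ} (κ : Kernel α (Fin k → ℝ)) : IsMarkovKernel (projKernel κ) :=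
  ⟨fun x => inferInstanceAs (IsProbabilityMeasure (Measure.dirac (∫ v, v ∂(κ x))))⟩

/-- The attention kernel `A_μ(x, ·) = Π[Ψ_{G(x,·)}(μ) L]`. -/
def attentionKernel {k : ℕ} (G : α → α → ℝ) (hG : Measurable (Function.uncurry G))
    (L : Kernel α (Fin k → ℝ)) (μ : ProbabilityMeasure α) : Kernel α (Fin k → ℝ) :=
  projKernel (L ∘ₖ softmatchKernel G hG μ)

/-- The uniform mixture `(1/H) ∑ₕ κₕ` of kernels. -/
def mixtureKernel {H : ℕ} (κ : Fin H → Kernel α β) : Kernel α β :=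
  ⟨fun x => (H : ℝ≥0∞)⁻¹ • (∑ h, κ h) x, Measure.measurable_of_measurable_coe _ fun s hs => by
    simpa only [Measure.smul_apply, smul_eq_mul] using
      ((∑ h, κ h).measurable_coe hs).const_mul _⟩

end Kernels

/-! ## The Transformer -/

/-- Parameters of an encoder layer on `E ⊆ ℝ^d` with `H` heads of dimension `d'`: query, key,
value and output matrices of every head, and a measurable feedforward map with values in `E`. -/
structure Transformer {d : ℕ} (E : Set (Fin d → ℝ)) (d' H : ℕ) where
  WQ : Fin H → Matrix (Fin d') (Fin d) ℝ
  WK : Fin H → Matrix (Fin d') (Fin d) ℝ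
  WV : Fin H → Matrix (Fin d') (Fin d) ℝ
  WO : Fin H → Matrix (Fin d') (Fin d) ℝ
  ffn : (Fin d → ℝ) → E
  measurable_ffn : Measurable ffn

/-- The softmatch weights `exp a(q,kᵢ) / ∑ⱼ exp a(q,kⱼ)`. -/
def softmatch {Q K : Type*} {N : ℕ} (a : Q → K → ℝ) (q : Q) (ks : Fin N → K) (i : Fin N) : ℝ :=
  Real.exp (a q (ks i)) / ∑ j, Real.exp (a q (ks j))

/-- `Attention(q, K, V) = ∑ᵢ softmatch(q, K)ᵢ vᵢ`. -/
def attention {Q K : Type*} {N k : ℕ} (a : Q → K → ℝ) (q : Q) (ks : Fin N → K)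
    (vs : Fin N → Fin k → ℝ) : Fin k → ℝ :=
  ∑ i, softmatch a q ks i • vs i

namespace Transformer

variable {d d' H : ℕ} {E : Set (Fin d → ℝ)} (θ : Transformer E d' H)

/-- The similarity `⟨W^Q x, W^K y⟩ / √d` of head `h`. -/
def score (h : Fin H) (x y : E) : ℝ :=
  ((θ.WQ h *ᵥ (x : Fin d → ℝ)) ⬝ᵥ (θ.WK h *ᵥ (y : Fin d → ℝ))) / Real.sqrt d

/-- Row-vector concatenation of the heads followed by the output matrix. -/
def multiHeadSelfAttention {N : ℕ} (X : Fin N → E) (i : Fin N) : Fin d → ℝ :=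
  ∑ h, attention (θ.score h) (X i) X (fun j => θ.WV h *ᵥ (X j : Fin d → ℝ)) ᵥ* θ.WO h

/-- `Transformer(X) = FFN ∘ MultiHeadSelfAttention(X)` on collections of `N` vectors. -/
def apply {N : ℕ} (X : Fin N → E) : Fin N → E :=
  fun i => θ.ffn (θ.multiHeadSelfAttention X i)

/-- The interaction potential `G(x, y) = exp a(x, y)` of head `h`. -/
def potential (h : Fin H) (x y : E) : ℝ := Real.exp (θ.score h x y)

lemma measurable_potential (h : Fin H) : Measurable (Function.uncurry (θ.potential h)) := by
  apply Continuous.measurable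
  unfold potential score Function.uncurry
  fun_prop

/-- The lookup kernel `L(y, ·) = δ_{W^V y}` of head `h`. -/
def lookupKernel (h : Fin H) : Kernel E (Fin d' → ℝ) :=
  Kernel.deterministic (fun y => θ.WV h *ᵥ (y : Fin d → ℝ))
    (Continuous.measurable (by fun_prop))

/-- The attention kernel `A^h_μ` of head `h`. -/
def headKernel (μ : ProbabilityMeasure E) (h : Fin H) : Kernel E (Fin d' → ℝ) :=
  attentionKernel (θ.potential h) (θ.measurable_potential h) (θ.lookupKernel h) μ

/-- The kernel `O^h(z, ·) = δ_{H · z W^O_h}`. -/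
def outputKernel (h : Fin H) : Kernel (Fin d' → ℝ) (Fin d → ℝ) :=
  Kernel.deterministic (fun z => (H : ℝ) • (z ᵥ* θ.WO h))
    (Continuous.measurable (by fun_prop))

/-- The multi-head attention kernel `M_μ = Π ∘ ((1/H) ∑ₕ A^h_μ O^h)`. -/
def multiHeadKernel (μ : ProbabilityMeasure E) : Kernel E (Fin d → ℝ) :=
  projKernel (mixtureKernel fun h => θ.outputKernel h ∘ₖ θ.headKernel μ h)

instance (μ : ProbabilityMeasure E) : IsMarkovKernel (θ.multiHeadKernel μ) :=
  inferInstanceAs (IsMarkovKernel (projKernel _))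

/-- The feedforward kernel `F(x, ·) = δ_{f(x)}`. -/
def ffnKernel : Kernel (Fin d → ℝ) E := Kernel.deterministic θ.ffn θ.measurable_ffn

instance : IsMarkovKernel θ.ffnKernel :=
  inferInstanceAs (IsMarkovKernel (Kernel.deterministic _ _))

/-- The self-attention Transformer kernel `T_μ = M_μ F`. -/
def kernel (μ : ProbabilityMeasure E) : Kernel E E := θ.ffnKernel ∘ₖ θ.multiHeadKernel μ

instance (μ : ProbabilityMeasure E) : IsMarkovKernel (θ.kernel μ) :=
  inferInstanceAs (IsMarkovKernel (θ.ffnKernel ∘ₖ θ.multiHeadKernel μ))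

/-- The nonlinear Markov transport `μ ↦ μ T_μ`. -/
def transport (μ : ProbabilityMeasure E) : ProbabilityMeasure E :=
  ⟨θ.kernel μ ∘ₘ (μ : Measure E), inferInstance⟩

end Transformer

end Attn

end

namespace Attn

/-! ### Transport distances to Dirac measures, and fixed points of shrinking maps on a compact set.
-/

section Wasserstein

variable {d : ℕ} {E : Set (Fin d → ℝ)}

/-! Every stage of the kernel is deterministic, so `transport` sends a Dirac measure to a Dirac
measure and induces a map on `E`. Between Dirac measures `W1` is the ℓ¹ distance, so a coefficient
below one makes this map strictly shrink distances, and compactness yields a fixed point `x`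
(`exists_fixedPoint_of_l1Dist_lt`). A second fixed measure would lie strictly closer to the Dirac
measure at `x` than itself. Only distances to Dirac measures occur; there the coupling is unique, so
neither completeness of `W1` nor its triangle inequality is needed.

For `N` tokens, `transport_empiricalPM` intertwines `apply` with `transport`. The empirical measure
of a fixed tuple is therefore the Dirac measure at `x`, which makes the tuple constant. -/

lemma l1Dist_nonneg (x y : Fin d → ℝ) : 0 ≤ l1Dist x y :=
  Finset.sum_nonneg fun _ _ => abs_nonneg _

lemma l1Dist_eq_zero {x y : Fin d → ℝ} (h : l1Dist x y = 0) : x = y := by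
  funext i
  have := (Finset.sum_eq_zero_iff_of_nonneg fun i _ => abs_nonneg (x i - y i)).1 h i
    (Finset.mem_univ i)
  exact sub_eq_zero.1 (abs_eq_zero.1 this)

lemma continuous_l1Dist : Continuous fun p : (Fin d → ℝ) × (Fin d → ℝ) => l1Dist p.1 p.2 := by
  unfold l1Dist
  fun_prop

lemma dist_le_l1Dist (x y : Fin d → ℝ) : dist x y ≤ l1Dist x y := by
  refine (dist_pi_le_iff (l1Dist_nonneg x y)).2 fun i => ?_
  rw [Real.dist_eq]
  exact Finset.single_le_sum (f := fun i => |x i - y i|) (fun _ _ => abs_nonneg _)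
    (Finset.mem_univ i)

lemma l1Dist_le_mul_dist (x y : Fin d → ℝ) : l1Dist x y ≤ d * dist x y := by
  have h : ∀ i ∈ Finset.univ, |x i - y i| ≤ dist x y := fun i _ => by
    rw [← Real.dist_eq]
    exact dist_le_pi_dist x y i
  simpa [l1Dist] using Finset.sum_le_sum h

lemma lintegral_l1Dist_lt_top (hE : IsCompact E) (μ : ProbabilityMeasure E) (y : Fin d → ℝ) :
    ∫⁻ x, ENNReal.ofReal (l1Dist (x : Fin d → ℝ) y) ∂(μ : Measure E) < ∞ := by
  have hc : Continuous fun x : Fin d → ℝ => l1Dist x y :=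
    continuous_l1Dist.comp (by fun_prop : Continuous fun x : Fin d → ℝ => (x, y))
  obtain ⟨C, hC⟩ := hE.bddAbove_image hc.continuousOn
  calc ∫⁻ x, ENNReal.ofReal (l1Dist (x : Fin d → ℝ) y) ∂(μ : Measure E)
      ≤ ∫⁻ _, ENNReal.ofReal C ∂(μ : Measure E) :=
        lintegral_mono fun x => ENNReal.ofReal_le_ofReal (hC ⟨x, x.2, rfl⟩)
    _ < ∞ := by simp

lemma mem_P1 (hE : IsCompact E) (μ : ProbabilityMeasure E) : μ ∈ P1 E :=
  lintegral_l1Dist_lt_top hE μ 0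

/-- The Dirac probability measure at `x`. -/
noncomputable def diracPM (x : E) : ProbabilityMeasure E := ⟨Measure.dirac x, inferInstance⟩

lemma measurable_ofReal_l1Dist (y : E) :
    Measurable fun x : E => ENNReal.ofReal (l1Dist (x : Fin d → ℝ) y) :=
  ENNReal.measurable_ofReal.comp (continuous_l1Dist.comp
    (by fun_prop : Continuous fun x : E => ((x : Fin d → ℝ), (y : Fin d → ℝ)))).measurable

/-- The only coupling with a Dirac measure is the product coupling. -/
lemma W1_diracPM (μ : ProbabilityMeasure E) (y : E) :
    W1 μ (diracPM y) = ∫⁻ x, ENNReal.ofReal (l1Dist (x : Fin d → ℝ) y) ∂(μ : Measure E) := by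
  have hm := measurable_ofReal_l1Dist y
  apply le_antisymm
  · have hm2 : Measurable fun x : E => (x, y) := by fun_prop
    suffices hπ : (μ : Measure E).map (fun x => (x, y)) ∈ couplings μ (diracPM y) from
      (iInf₂_le _ hπ).trans (lintegral_map_le _ _)
    refine ⟨?_, ?_⟩
    · rw [Measure.map_map measurable_fst hm2]
      exact Measure.map_id
    · rw [Measure.map_map measurable_snd hm2]
      have : (Prod.snd ∘ fun x : E => (x, y)) = fun _ => y := rfl
      rw [this, Measure.map_const]
      simp [diracPM]
  · refine le_iInf₂ fun π hπ => ?_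
    have hsnd : ∀ᵐ p ∂π, p.2 = y := by
      have h : ∀ᵐ z ∂(π.map Prod.snd), z = y := by
        rw [hπ.2]
        exact (ae_dirac_iff (measurableSet_singleton y)).2 rfl
      exact ae_of_ae_map measurable_snd.aemeasurable h
    rw [← hπ.1, lintegral_map hm measurable_fst]
    refine (lintegral_congr_ae ?_).le
    filter_upwards [hsnd] with p hp
    rw [hp]

lemma W1_diracPM_diracPM (x y : E) :
    W1 (diracPM x) (diracPM y) = ENNReal.ofReal (l1Dist (x : Fin d → ℝ) y) := by
  rw [W1_diracPM]
  exact lintegral_dirac _ _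

lemma eq_diracPM_of_W1_eq_zero {μ : ProbabilityMeasure E} {y : E} (h : W1 μ (diracPM y) = 0) :
    μ = diracPM y := by
  rw [W1_diracPM, lintegral_eq_zero_iff (measurable_ofReal_l1Dist y)] at h
  have hy : (fun x : E => x) =ᵐ[(μ : Measure E)] fun _ => y := by
    filter_upwards [h] with x hx
    exact Subtype.ext (l1Dist_eq_zero
      (le_antisymm (ENNReal.ofReal_eq_zero.1 hx) (l1Dist_nonneg _ _)))
  apply Subtype.ext
  have := Measure.map_congr (mβ := inferInstance) hy
  rw [Measure.map_id', Measure.map_const] at this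
  simpa [diracPM] using this

/-- Clearing the denominator in `ℝ≥0∞` needs a nonzero, finite distance. Comparing with a Dirac
measure supplies the first, compactness the second. -/
lemma W1_lt_of_contractionCoeff_lt_one (hE : IsCompact E)
    {Φ : ProbabilityMeasure E → ProbabilityMeasure E} (hΦ : contractionCoeff Φ < 1)
    {μ : ProbabilityMeasure E} {y : E} (hne : μ ≠ diracPM y) :
    W1 (Φ μ) (Φ (diracPM y)) < W1 μ (diracPM y) := by
  have h0 : W1 μ (diracPM y) ≠ 0 := fun h => hne (eq_diracPM_of_W1_eq_zero h)
  have htop : W1 μ (diracPM y) ≠ ∞ := by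
    rw [W1_diracPM]
    exact (lintegral_l1Dist_lt_top hE μ y).ne
  have hle : W1 (Φ μ) (Φ (diracPM y)) / W1 μ (diracPM y) ≤ contractionCoeff Φ :=
    le_iSup₂_of_le μ (mem_P1 hE μ) (le_iSup₂_of_le (diracPM y) (mem_P1 hE _)
      (le_iSup_of_le hne le_rfl))
  simpa using (ENNReal.div_lt_iff (Or.inl h0) (Or.inl htop)).1 (hle.trans_lt hΦ)

/-- A map strictly decreasing the `ℓ¹` distance of distinct points of a nonempty compact set
has a fixed point. -/
lemma exists_fixedPoint_of_l1Dist_lt [Nonempty E] (hE : IsCompact E) (φ : E → E)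
    (hφ : ∀ x y : E, x ≠ y → l1Dist (φ x : Fin d → ℝ) (φ y) < l1Dist (x : Fin d → ℝ) y) :
    ∃ x, φ x = x := by
  have : CompactSpace E := isCompact_iff_compactSpace.1 hE
  have hc : Continuous φ := by
    -- The ambient metric is the sup metric; passing to ℓ¹ costs the factor `d`, harmless for
    -- continuity.
    refine (LipschitzWith.of_dist_le_mul (K := d) fun x y => ?_).continuous
    rcases eq_or_ne x y with rfl | hxy
    · simp
    · exact (dist_le_l1Dist _ _).trans ((hφ x y hxy).le.trans (l1Dist_le_mul_dist _ _))
  have hcont : Continuous fun x : E => l1Dist (φ x : Fin d → ℝ) x :=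
    continuous_l1Dist.comp
      (by fun_prop : Continuous fun x : E => ((φ x : Fin d → ℝ), (x : Fin d → ℝ)))
  -- At a minimiser of the displacement, `φ x ≠ x` would give `φ x` a smaller displacement.
  obtain ⟨x, -, hx⟩ := isCompact_univ.exists_isMinOn (Set.univ_nonempty (α := E))
    hcont.continuousOn
  refine ⟨x, by_contra fun h => ?_⟩
  exact (hφ (φ x) x h).not_ge (hx (Set.mem_univ (φ x)))

end Wasserstein

/-! ### Empirical measures and softmax averages. -/

section Empirical

variable {α : Type*} [MeasurableSpace α] {N : ℕ}

/-- The empirical measure `(1/N) ∑ᵢ δ_{Xᵢ}`. -/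
noncomputable def empirical (X : Fin N → α) : Measure α := (N : ℝ≥0∞)⁻¹ • ∑ i, Measure.dirac (X i)

instance [NeZero N] (X : Fin N → α) : IsProbabilityMeasure (empirical X) :=
  ⟨by simp [empirical, ENNReal.inv_mul_cancel, NeZero.ne N]⟩

/-- The empirical measure as a probability measure. -/
noncomputable def empiricalPM [NeZero N] (X : Fin N → α) : ProbabilityMeasure α := ⟨empirical X, inferInstance⟩

lemma integral_empirical {k : ℕ} [MeasurableSingletonClass α] (X : Fin N → α)
    (g : α → Fin k → ℝ) : ∫ x, g x ∂(empirical X) = (N : ℝ)⁻¹ • ∑ i, g (X i) := by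
  rw [empirical, integral_smul_measure, integral_finsetSum_measure]
  · simp
  · exact fun i _ => integrable_dirac (by simp)

lemma integral_empirical_real [MeasurableSingletonClass α] (X : Fin N → α)
    (g : α → ℝ) : ∫ x, g x ∂(empirical X) = (N : ℝ)⁻¹ * ∑ i, g (X i) := by
  rw [empirical, integral_smul_measure, integral_finsetSum_measure]
  · simp
  · exact fun i _ => integrable_dirac (by simp)

end Empirical

section EmpiricalDirac

variable {d N : ℕ} [NeZero N] {E : Set (Fin d → ℝ)}

lemma empiricalPM_eq_diracPM_iff (X : Fin N → E) (x : E) :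
    empiricalPM X = diracPM x ↔ ∀ i, X i = x := by
  constructor
  · intro h i
    have hm : empirical X = Measure.dirac x := congrArg Subtype.val h
    -- No mass lies off `x`, and the atoms have positive weight, so none of them lies off `x`.
    have h0 : empirical X {x}ᶜ = 0 := by
      rw [hm]
      simp
    simp only [empirical, Measure.smul_apply, Measure.finsetSum_apply, smul_eq_mul, mul_eq_zero,
      ENNReal.inv_eq_zero, ENNReal.natCast_ne_top, false_or, Finset.sum_eq_zero_iff] at h0
    simpa using h0 i (Finset.mem_univ i)
  · intro h
    apply Subtype.ext
    change empirical X = Measure.dirac x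
    have hN : (N : ℝ≥0∞) ≠ 0 := by simp [NeZero.ne N]
    ext s hs
    simp only [empirical, h, Finset.sum_const, Finset.card_univ, Fintype.card_fin,
      Measure.smul_apply, smul_eq_mul, nsmul_eq_mul]
    rw [← mul_assoc, ENNReal.inv_mul_cancel hN (ENNReal.natCast_ne_top N), one_mul]

end EmpiricalDirac

lemma integral_boltzmannGibbs {α : Type*} [MeasurableSpace α] {k : ℕ} {g : α → ℝ}
    (hg : Measurable g) (hpos : ∀ x, 0 ≤ g x) (μ : Measure α) (v : α → Fin k → ℝ) :
    ∫ y, v y ∂(boltzmannGibbs g μ) = ∫ y, (g y / ∫ z, g z ∂μ) • v y ∂μ := by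
  rw [boltzmannGibbs, integral_withDensity_eq_integral_toReal_smul
    (hg.div_const _).ennreal_ofReal (by simp)]
  refine integral_congr_ae (Filter.Eventually.of_forall fun y => ?_)
  simp only
  rw [ENNReal.toReal_ofReal (div_nonneg (hpos y) (integral_nonneg hpos))]

/-- The factor `1/N` cancels between numerator and normalisation, leaving the softmax weights. -/
lemma integral_boltzmannGibbs_exp_empirical {α : Type*} [MeasurableSpace α]
    [MeasurableSingletonClass α] {N k : ℕ} [NeZero N] (a : α → ℝ)
    (ha : Measurable fun y => Real.exp (a y)) (X : Fin N → α) (v : α → Fin k → ℝ) :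
    ∫ y, v y ∂(boltzmannGibbs (fun y => Real.exp (a y)) (empirical X)) =
      ∑ i, (Real.exp (a (X i)) / ∑ j, Real.exp (a (X j))) • v (X i) := by
  have hN : (N : ℝ) ≠ 0 := Nat.cast_ne_zero.2 (NeZero.ne N)
  rw [integral_boltzmannGibbs ha (fun _ => (Real.exp_pos _).le), integral_empirical,
    integral_empirical_real, Finset.smul_sum]
  refine Finset.sum_congr rfl fun i _ => ?_
  rw [smul_smul, mul_div_assoc', mul_div_mul_left _ _ (inv_ne_zero hN)]

/-! ### The kernels as point masses, and their action on empirical measures. -/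

namespace Transformer

variable {d d' H : ℕ} {E : Set (Fin d → ℝ)} (θ : Transformer E d' H)

/-- The output of head `h` at `x` when attending to `μ`. -/
noncomputable def headMean (μ : ProbabilityMeasure E) (h : Fin H) (x : E) : Fin d' → ℝ :=
  ∫ y : E, θ.WV h *ᵥ (y : Fin d → ℝ) ∂(boltzmannGibbs (θ.potential h x) (μ : Measure E))

lemma headKernel_apply (μ : ProbabilityMeasure E) (h : Fin H) (x : E) :
    θ.headKernel μ h x = Measure.dirac (θ.headMean μ h x) := by
  have hm : Measurable fun y : E => θ.WV h *ᵥ (y : Fin d → ℝ) :=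
    Continuous.measurable (by fun_prop)
  change Measure.dirac (∫ v, v ∂((θ.lookupKernel h ∘ₖ
    softmatchKernel (θ.potential h) (θ.measurable_potential h) μ) x)) = _
  rw [lookupKernel, Kernel.deterministic_comp_eq_map, Kernel.map_apply _ hm,
    integral_map hm.aemeasurable (by fun_prop)]
  rfl

lemma outputKernel_comp_headKernel_apply (μ : ProbabilityMeasure E) (h : Fin H) (x : E) :
    (θ.outputKernel h ∘ₖ θ.headKernel μ h) x =
      Measure.dirac ((H : ℝ) • (θ.headMean μ h x ᵥ* θ.WO h)) := by
  rw [Kernel.comp_apply, headKernel_apply, Measure.dirac_bind (Kernel.measurable _),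
    outputKernel, Kernel.deterministic_apply]

lemma multiHeadKernel_apply (μ : ProbabilityMeasure E) (x : E) :
    θ.multiHeadKernel μ x = Measure.dirac (∑ h, θ.headMean μ h x ᵥ* θ.WO h) := by
  change Measure.dirac (∫ v, v ∂((H : ℝ≥0∞)⁻¹ •
    (∑ h, (θ.outputKernel h ∘ₖ θ.headKernel μ h)) x)) = _
  congr 1
  rw [_root_.sum_apply, integral_smul_measure]
  simp only [outputKernel_comp_headKernel_apply]
  rw [integral_finsetSum_measure fun h _ => integrable_dirac (by simp)]
  simp only [integral_dirac, ← Finset.smul_sum]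
  -- The factor `H` in `outputKernel` cancels the mixture weight; without heads both sides vanish.
  rcases Nat.eq_zero_or_pos H with rfl | hH
  · simp
  · have : (H : ℝ) ≠ 0 := by positivity
    simp [smul_smul, this]

lemma kernel_apply (μ : ProbabilityMeasure E) (x : E) :
    θ.kernel μ x = Measure.dirac (θ.ffn (∑ h, θ.headMean μ h x ᵥ* θ.WO h)) := by
  rw [kernel, Kernel.comp_apply, multiHeadKernel_apply, Measure.dirac_bind (Kernel.measurable _),
    ffnKernel, Kernel.deterministic_apply]

variable {N : ℕ} [NeZero N]

lemma headMean_empiricalPM (X : Fin N → E) (h : Fin H) (x : E) :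
    θ.headMean (empiricalPM X) h x =
      attention (θ.score h) x X (fun j => θ.WV h *ᵥ (X j : Fin d → ℝ)) :=
  integral_boltzmannGibbs_exp_empirical (θ.score h x)
    (Measurable.of_uncurry_left (θ.measurable_potential h)) X _

lemma transport_empiricalPM (X : Fin N → E) :
    θ.transport (empiricalPM X) = empiricalPM (θ.apply X) := by
  apply Subtype.ext
  change (empirical X).bind (θ.kernel (empiricalPM X)) = empirical (θ.apply X)
  ext s hs
  rw [Measure.bind_apply hs (Kernel.measurable _).aemeasurable]
  simp only [kernel_apply, headMean_empiricalPM]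
  simp only [empirical, lintegral_smul_measure, lintegral_finsetSum_measure, lintegral_dirac,
    Measure.smul_apply, Measure.finsetSum_apply]
  rfl

end Transformer

end Attn

theorem mainTheorem12 {d d' H : ℕ} (E : Set (Fin d → ℝ)) (hE : IsCompact E)
    (θ : Attn.Transformer E d' H) (hτ : Attn.contractionCoeff θ.transport < 1) :
    (∃! μ : ProbabilityMeasure E, μ ∈ Attn.P1 E ∧ θ.transport μ = μ) ∧
      ∀ N : ℕ, 0 < N → ∃! X : Fin N → E, θ.apply X = X := by
  -- The feedforward map takes values in `E`, so `E` is nonempty.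
  have : Nonempty E := ⟨θ.ffn 0⟩
  -- A Dirac measure is the empirical measure of a single token, so the case `N = 1` gives the
  -- induced map on `E`.
  have hdirac (x : E) : θ.transport (Attn.diracPM x) =
      Attn.diracPM (θ.apply (fun _ : Fin 1 => x) 0) := by
    rw [← (Attn.empiricalPM_eq_diracPM_iff (fun _ : Fin 1 => x) x).2 fun _ => rfl,
      θ.transport_empiricalPM, Attn.empiricalPM_eq_diracPM_iff]
    intro i
    rw [Subsingleton.elim i 0]
  have hinj {x y : E} (h : Attn.diracPM x = Attn.diracPM y) : x = y := by
    rw [← (Attn.empiricalPM_eq_diracPM_iff (fun _ : Fin 1 => x) x).2 fun _ => rfl,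
      Attn.empiricalPM_eq_diracPM_iff] at h
    exact h 0
  obtain ⟨x, hx⟩ := Attn.exists_fixedPoint_of_l1Dist_lt hE
    (fun x => θ.apply (fun _ : Fin 1 => x) 0) fun x y hxy => by
      have h := Attn.W1_lt_of_contractionCoeff_lt_one hE hτ fun h => hxy (hinj h)
      rw [hdirac, hdirac, Attn.W1_diracPM_diracPM, Attn.W1_diracPM_diracPM] at h
      exact (ENNReal.ofReal_lt_ofReal_iff_of_nonneg (Attn.l1Dist_nonneg _ _)).1 h
  have hfix : θ.transport (Attn.diracPM x) = Attn.diracPM x := by rw [hdirac, hx]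
  have huniq (μ : ProbabilityMeasure E) (hμ : θ.transport μ = μ) : μ = Attn.diracPM x := by
    by_contra hne
    have h := Attn.W1_lt_of_contractionCoeff_lt_one hE hτ hne
    rw [hμ, hfix] at h
    exact h.false
  refine ⟨⟨Attn.diracPM x, ⟨Attn.mem_P1 hE _, hfix⟩, fun μ hμ => huniq μ hμ.2⟩, fun N hN => ?_⟩
  have : NeZero N := ⟨hN.ne'⟩
  refine ⟨fun _ => x, ?_, fun X hX => ?_⟩
  -- The constant tuple has a fixed Dirac measure as empirical measure, so all its output tokens
  -- equal `x`.
  · funext i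
    refine (Attn.empiricalPM_eq_diracPM_iff _ x).1 ?_ i
    rw [← θ.transport_empiricalPM, (Attn.empiricalPM_eq_diracPM_iff (fun _ => x) x).2 fun _ => rfl,
      hfix]
  · funext i
    refine (Attn.empiricalPM_eq_diracPM_iff X x).1 (huniq _ ?_) i
    rw [θ.transport_empiricalPM, hX]
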